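/- A link diagram on $S^2$ is taken up to the usual combinatorial equivalence: a 4-valent plane map on the sphere (given by $n$ crossings, the counterclockwise order of the four half-edges at each crossing, and the pairing of half-edges into edges, subject to the sphericity condition that vertices minus edges plus faces is twice the number of connected components), with the over-strand marked at each crossing, together with finitely many crossingless circle components. The diagram is alternating if over- and undercrossings alternate along each component. For $k\ge 0$, it is $k$-almost alternating if there is a set of $k$ crossings, and no set of fewer crossings, such that the diagram becomes alternating when all crossings of the set are switched; the crossings of such a $k$-element set $T$ are called dealternators. The diagram, with the set $T$ of dealternators, is dealternator connected if each of the $2^k$ diagrams obtained by smoothing every dealternator in $T$ in one of the two possible ways, leaving the other crossings as they are, is connected (has exactly one connected component as a subset of $S^2$; for $k=0$ this says that the diagram itself is connected). Let $|s_AD|$ (resp. $|s_BD|$) be the number of circles obtained by $A$-smoothing (resp. $B$-smoothing) all crossings of $D$. **Theorem.** Let $D$ be a $k$-almost alternating link diagram with $n$ crossings which is dealternator connected with respect to some set $T$ of $k$ dealternators. Then $$|s_AD|+|s_BD| = n+2-2k.$$ -/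

import Mathlib

/-! Link diagrams on the oriented sphere, as 4-valent plane maps with over/under information. -/

/-- The half-edges (darts) of a diagram with `n` crossings: `(c, i)` is the `i`-th of the four
half-edges at the crossing `c`, numbered counterclockwise. So `(c, 0)` and `(c, 2)` form one strand
through `c`, and `(c, 1)` and `(c, 3)` the other one. -/
abbrev Dart (n : ℕ) : Type := Fin n × ZMod 4

/-- The next half-edge counterclockwise at the same crossing. -/
def Dart.ccw {n : ℕ} (d : Dart n) : Dart n := (d.1, d.2 + 1)

/-- A link projection with `n` double points on the sphere: a 4-valent plane map (rotation system
of genus zero), together with a number of simple closed curves without double points. -/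
structure LinkProjection (n : ℕ) where
  /-- The other half of the edge that a given half-edge belongs to. -/
  edge : Dart n → Dart n
  edge_edge : ∀ d, edge (edge d) = d
  edge_ne : ∀ d, edge d ≠ d
  /-- The number of crossingless circle components. -/
  freeCircles : ℕ
  /-- The map is spherical: vertices minus edges plus faces is twice the number of connected
  components. Edges are the orbits of `edge`, faces those of `ccw ∘ edge`, and connected
  components those of `edge` and `ccw` together. -/
  spherical :
    (n : ℤ) - Nat.card (Quot fun d d' : Dart n => d' = edge d)
        + Nat.card (Quot fun d d' : Dart n => d' = (edge d).ccw)
      = 2 * Nat.card (Quot fun d d' : Dart n => d' = edge d ∨ d' = d.ccw)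

/-- A link diagram with `n` crossings: a projection, and for each crossing the information
which of the two strands is the overcrossing one. -/
structure LinkDiagram (n : ℕ) extends LinkProjection n where
  /-- `true` if the strand formed by the half-edges `0` and `2` is the over-strand, `false` if the
  one formed by `1` and `3` is. -/
  evenOver : Fin n → Bool

/-- What is done at a crossing: it is left as it is, A-smoothed, or B-smoothed. -/
inductive Resolution : Type
  | keep
  | smoothA
  | smoothB

namespace LinkDiagram

variable {n : ℕ}

/-- The half-edge `d` belongs to the over-strand of its crossing. -/
def IsOver (D : LinkDiagram n) (d : Dart n) : Prop :=
  (d.2 = 0 ∨ d.2 = 2) ↔ D.evenOver d.1 = true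

/-- The diagram is alternating: along every strand over- and undercrossings alternate, that is,
each edge has one over-end and one under-end. -/
def IsAlternating (D : LinkDiagram n) : Prop :=
  ∀ d, D.IsOver (D.edge d) ↔ ¬ D.IsOver d

/-- Switch (exchange over- and under-strand at) the crossings in `T`. -/
def switch (D : LinkDiagram n) (T : Finset (Fin n)) : LinkDiagram n :=
  { D with evenOver := fun c => if c ∈ T then !D.evenOver c else D.evenOver c }

/-- `T` is a set of `k` crossings such that switching all of them makes the diagram alternating. -/
def IsDealternatorSet (D : LinkDiagram n) (k : ℕ) (T : Finset (Fin n)) : Prop :=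
  T.card = k ∧ (D.switch T).IsAlternating

/-- `D` is `k`-almost alternating: some set of `k` crossings, and no smaller one, makes `D`
alternating when switched. -/
def IsAlmostAlternating (D : LinkDiagram n) (k : ℕ) : Prop :=
  (∃ T, D.IsDealternatorSet k T) ∧ ∀ j T, D.IsDealternatorSet j T → k ≤ j

/-- Direct connection of half-edges in the diagram obtained from `D` by resolving the crossings
as `s` prescribes: along edges, at kept crossings between all four half-edges, and at smoothed
crossings along the two arcs of the smoothing. The A-smoothing opens a channel between the two
corners swept out when the over-strand is rotated counterclockwise; its arcs therefore join each
under-half-edge with the next half-edge counterclockwise. For the B-smoothing it is the other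
way round. -/
def Joined (D : LinkDiagram n) (s : Fin n → Resolution) (d d' : Dart n) : Prop :=
  d' = D.edge d ∨
  (s d.1 = Resolution.keep ∧ d' = d.ccw) ∨
  (s d.1 = Resolution.smoothA ∧ ¬ D.IsOver d ∧ d' = d.ccw) ∨
  (s d.1 = Resolution.smoothB ∧ D.IsOver d ∧ d' = d.ccw)

/-- The number of connected components (as a subset of the sphere) of the diagram obtained from `D`
by resolving the crossings as `s` prescribes. -/
noncomputable def numComponents (D : LinkDiagram n) (s : Fin n → Resolution) : ℕ :=
  Nat.card (Quot (D.Joined s)) + D.freeCircles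

/-- `|s_A D|`: the number of circles after A-smoothing every crossing. -/
noncomputable def circlesA (D : LinkDiagram n) : ℕ :=
  D.numComponents fun _ => Resolution.smoothA

/-- `|s_B D|`: the number of circles after B-smoothing every crossing. -/
noncomputable def circlesB (D : LinkDiagram n) : ℕ :=
  D.numComponents fun _ => Resolution.smoothB

/-- `D` with the set `T` of dealternators is dealternator connected: smoothing all crossings in
`T`, each in either way, and no other crossing, always gives a connected diagram. -/
def IsDealternatorConnected (D : LinkDiagram n) (T : Finset (Fin n)) : Prop :=
  ∀ s : Fin n → Resolution, (∀ c, s c = Resolution.keep ↔ c ∉ T) → D.numComponents s = 1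

end LinkDiagram

/-! Switching `T` makes `D` an alternating diagram `E`. Write (t,u) for the number of circles of `E`
with `T` t-smoothed and the other crossings u-smoothed. Switching exchanges the two smoothings, so,
without free circles, |s_A D| = (B,A) and |s_B D| = (A,B).

Once some crossings of an alternating diagram are smoothed, the faces of the resulting map are the
circles of its two uniform completions (`card_circles_add_card_circles`). With no crossing smoothed,
sphericity gives (A,A) + (B,B) ≥ n+2. With `T` smoothed uniformly the map is connected, and
nonnegativity of the genus gives (A,A) + (A,B) ≤ n+2-k and (B,A) + (B,B) ≤ n+2-k. Together these
yield (A,B) + (B,A) ≤ n+2-2k.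

Conversely, changing one smoothing changes the number of circles by at most one
(`card_joined_le_add_card`), so (A,A) ≤ (B,A) + k and (B,B) ≤ (A,B) + k, whence (A,B) + (B,A) ≥
n+2-2k. The genus inequality holds for any two permutations of a finite set, so the resolved maps
need not be shown spherical. -/

/-! ### Counting classes when a relation is enlarged. -/

section Quotients

variable {X : Type*} [Finite X]

theorem card_quot_le_of_rel_imp {r r' : X → X → Prop}
    (h : ∀ x y, r x y → Quot.mk r' x = Quot.mk r' y) :
    Nat.card (Quot r') ≤ Nat.card (Quot r) :=
  Nat.card_le_card_of_surjective (Quot.lift (Quot.mk r') h)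
    fun q => Quot.inductionOn q fun x => ⟨Quot.mk r x, rfl⟩

/-- Identifying two inequivalent elements lowers the number of classes. -/
theorem card_quot_lt_of_rel_imp {r r' : X → X → Prop}
    (h : ∀ x y, r x y → Quot.mk r' x = Quot.mk r' y) {a b : X}
    (hab : Quot.mk r a ≠ Quot.mk r b) (hab' : Quot.mk r' a = Quot.mk r' b) :
    Nat.card (Quot r') < Nat.card (Quot r) := by
  refine lt_of_le_of_ne (card_quot_le_of_rel_imp h) fun he => hab ?_
  have hs : Function.Surjective (Quot.lift (Quot.mk r') h) :=
    fun q => Quot.inductionOn q fun x => ⟨Quot.mk r x, rfl⟩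
  exact ((Nat.bijective_iff_surjective_and_card _).2 ⟨hs, he.symm⟩).1 hab'

/-- Identifying the classes of two elements lowers the number of classes by at most one. -/
theorem card_quot_le_card_quot_add_one {r r' : X → X → Prop} (a b : X)
    (h : ∀ x y, r' x y → Quot.mk r x = Quot.mk r y ∨
      (Quot.mk r x = Quot.mk r a ∧ Quot.mk r y = Quot.mk r b) ∨
      (Quot.mk r x = Quot.mk r b ∧ Quot.mk r y = Quot.mk r a)) :
    Nat.card (Quot r) ≤ Nat.card (Quot r') + 1 := by
  classical
  -- Redirecting the class of `a` to that of `b` makes the map respect `r'`; the extra point of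
  -- `Option` recovers the class of `a`.
  let g : X → Quot r := fun x => if Quot.mk r x = Quot.mk r a then Quot.mk r b else Quot.mk r x
  have hg : ∀ x y, r' x y → g x = g y := by
    intro x y hxy
    rcases h x y hxy with h | ⟨h₁, h₂⟩ | ⟨h₁, h₂⟩
    · simp only [g, h]
    · simp only [g, h₁, h₂, if_true, ite_self]
    · simp only [g, h₁, h₂, if_true, ite_self]
  have hs : Function.Surjective
      (fun o : Option (Quot r') => o.elim (Quot.mk r a) (Quot.lift g hg)) := by
    intro q
    induction q using Quot.inductionOn with
    | h x =>
      by_cases hx : Quot.mk r x = Quot.mk r a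
      · exact ⟨none, hx.symm⟩
      · exact ⟨some (Quot.mk r' x), if_neg hx⟩
  calc Nat.card (Quot r) ≤ Nat.card (Option (Quot r')) := Nat.card_le_card_of_surjective _ hs
    _ = Nat.card (Quot r') + 1 := Finite.card_option

end Quotients

/-! ### Orbits of permutations and the genus inequality. -/

namespace Equiv.Perm

variable {X : Type*}

/-- The number of orbits of a permutation, fixed points included. -/
noncomputable def numOrbits (f : Perm X) : ℕ := Nat.card (Quot fun x y => y = f x)

/-- The number of orbits of the group generated by two permutations. -/
noncomputable def numOrbits₂ (f g : Perm X) : ℕ := Nat.card (Quot fun x y => y = g x ∨ y = f x)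

theorem mk_orbit_eq_of_pow (f : Perm X) (x : X) (m : ℕ) :
    Quot.mk (fun x y => y = f x) ((f ^ m) x) = Quot.mk (fun x y => y = f x) x := by
  induction m with
  | zero => rfl
  | succ m ih =>
    rw [← ih, pow_succ']
    exact (Quot.sound (r := fun x y => y = f x) rfl).symm

theorem mk_orbit₂_eq_of_mk_orbit_mul_eq (f g : Perm X) {x y : X}
    (h : Quot.mk (fun u v => v = (f * g) u) x = Quot.mk _ y) :
    Quot.mk (fun u v => v = g u ∨ v = f u) x = Quot.mk _ y := by
  refine congrArg (Quot.lift (Quot.mk (fun u v => v = g u ∨ v = f u)) ?_) h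
  rintro u v rfl
  have h₁ : Quot.mk (fun u v => v = g u ∨ v = f u) u = Quot.mk _ (g u) := Quot.sound (Or.inl rfl)
  exact h₁.trans (Quot.sound (Or.inr rfl))

variable [Finite X] [DecidableEq X]

theorem numOrbits_swap_mul_le (f : Perm X) (x y : X) :
    (swap x y * f).numOrbits ≤ f.numOrbits + 1 := by
  refine card_quot_le_card_quot_add_one x y fun u v huv => ?_
  subst huv
  have hu : Quot.mk (fun u v => v = (swap x y * f) u) u = Quot.mk _ (swap x y (f u)) :=
    Quot.sound rfl
  rw [hu]
  by_cases hx : f u = x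
  · rw [hx, swap_apply_left]
    exact Or.inr (Or.inr ⟨rfl, rfl⟩)
  · by_cases hy : f u = y
    · rw [hy, swap_apply_right]
      exact Or.inr (Or.inl ⟨rfl, rfl⟩)
    · rw [swap_apply_of_ne_of_ne hx hy]
      exact Or.inl rfl

/-- Composing with a transposition of two points in different orbits joins these orbits. -/
theorem mk_orbit_swap_mul_eq (f : Perm X) (x y : X)
    (h : Quot.mk (fun u v => v = f u) x ≠ Quot.mk _ y) :
    Quot.mk (fun u v => v = (swap x y * f) u) x = Quot.mk _ y := by
  classical
  have hex : ∃ m, (f ^ (m + 1)) x = x := by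
    obtain ⟨m, hm, hf⟩ := (isOfFinOrder_of_finite f).exists_pow_eq_one
    exact ⟨m - 1, by rw [Nat.sub_add_cancel hm, hf]; rfl⟩
  -- The two orbits of `x` agree until `f` would return to `x`, since `y` is never met; at that step
  -- the transposition diverts to `y`.
  have key : ∀ m ≤ Nat.find hex, ((swap x y * f) ^ m) x = (f ^ m) x := by
    intro m
    induction m with
    | zero => intro _; rfl
    | succ m ih =>
      intro hm
      rw [pow_succ', mul_apply, ih (by omega), mul_apply, ← mul_apply f, ← pow_succ']
      refine swap_apply_of_ne_of_ne (Nat.find_min hex (by omega)) fun hy => h ?_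
      rw [← hy, mk_orbit_eq_of_pow]
  have hlast : ((swap x y * f) ^ (Nat.find hex + 1)) x = y := by
    rw [pow_succ', mul_apply, key _ le_rfl, mul_apply, ← mul_apply f, ← pow_succ',
      Nat.find_spec hex, swap_apply_left]
  rw [← mk_orbit_eq_of_pow _ x, hlast]

theorem numOrbits_swap_mul_lt (f : Perm X) (x y : X)
    (h : Quot.mk (fun u v => v = f u) x ≠ Quot.mk _ y) :
    (swap x y * f).numOrbits < f.numOrbits := by
  have hxy := mk_orbit_swap_mul_eq f x y h
  refine card_quot_lt_of_rel_imp (fun u v huv => ?_) h hxy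
  subst huv
  have hu : Quot.mk (fun u v => v = (swap x y * f) u) u = Quot.mk _ (swap x y (f u)) :=
    Quot.sound rfl
  rw [hu]
  by_cases hx : f u = x
  · rw [hx, swap_apply_left, hxy]
  · by_cases hy : f u = y
    · rw [hy, swap_apply_right, hxy]
    · rw [swap_apply_of_ne_of_ne hx hy]

/-- The genus of a pair of permutations is nonnegative. -/
theorem numOrbits_add_numOrbits_add_numOrbits_mul_le (f g : Perm X) :
    f.numOrbits + g.numOrbits + (f * g).numOrbits ≤ Nat.card X + 2 * numOrbits₂ f g := by
  cases nonempty_fintype X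
  induction hm : f.support.card using Nat.strong_induction_on generalizing f with
  | _ m ih =>
  by_cases hf : ∀ x, f x = x
  · obtain rfl : f = 1 := Equiv.ext hf
    have h₁ : numOrbits (1 : Perm X) ≤ Nat.card X :=
      Nat.card_le_card_of_surjective (Quot.mk _) Quot.mk_surjective
    have h₂ : g.numOrbits ≤ numOrbits₂ 1 g := card_quot_le_of_rel_imp (by
      rintro x y (rfl | rfl)
      · exact Quot.sound rfl
      · rfl)
    rw [one_mul]
    omega
  · push Not at hf
    obtain ⟨x, hx⟩ := hf
    -- Split off a transposition so that `e` fixes `x` and has smaller support.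
    obtain ⟨e, he⟩ : ∃ e, e = swap x (f x) * f := ⟨_, rfl⟩
    have hfe : f = swap x (f x) * e := by rw [he, swap_mul_self_mul]
    have hex : e x = x := by rw [he, mul_apply, swap_apply_right]
    have hI := ih e.support.card (by rw [← hm, he]; exact card_support_swap_mul hx) e rfl
    generalize f x = y at hx hfe
    subst hfe
    -- `x` alone is an orbit of `e`, so `f` has fewer orbits than `e`.
    have hsep : Quot.mk (fun u v => v = e u) x ≠ Quot.mk _ y := by
      intro h
      have := congrArg (Quot.lift (fun u => u = x) (by
        rintro u v rfl
        refine propext ⟨?_, fun h => e.injective (h.trans hex.symm)⟩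
        rintro rfl
        exact hex)) h
      exact hx (this.mp rfl)
    have h₁ := numOrbits_swap_mul_lt e x y hsep
    have hcon : numOrbits₂ e g ≤ numOrbits₂ (swap x y * e) g + 1 := by
      refine card_quot_le_card_quot_add_one x y ?_
      rintro u v (rfl | rfl)
      · exact Or.inl (Quot.sound (Or.inl rfl))
      · have hu : Quot.mk (fun u v => v = g u ∨ v = e u) u = Quot.mk _ (e u) :=
          Quot.sound (Or.inr rfl)
        rw [hu, mul_apply]
        by_cases hux : e u = x
        · rw [hux, swap_apply_left]
          exact Or.inr (Or.inl ⟨rfl, rfl⟩)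
        · by_cases huy : e u = y
          · rw [huy, swap_apply_right]
            exact Or.inr (Or.inr ⟨rfl, rfl⟩)
          · rw [swap_apply_of_ne_of_ne hux huy]
            exact Or.inl rfl
    -- If `x` and `y` share an orbit of `e * g`, it may split, but the components are unchanged.
    -- Otherwise two orbits merge, which pays for the possible loss of one component, counted twice.
    by_cases h : Quot.mk (fun u v => v = (e * g) u) x = Quot.mk _ y
    · have h₂ := numOrbits_swap_mul_le (e * g) x y
      have hxy := mk_orbit₂_eq_of_mk_orbit_mul_eq e g h
      have hcon' : numOrbits₂ e g ≤ numOrbits₂ (swap x y * e) g := by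
        refine card_quot_le_of_rel_imp ?_
        rintro u v (rfl | rfl)
        · exact Quot.sound (Or.inl rfl)
        · have hu : Quot.mk (fun u v => v = g u ∨ v = e u) u = Quot.mk _ (e u) :=
            Quot.sound (Or.inr rfl)
          rw [hu, mul_apply]
          by_cases hux : e u = x
          · rw [hux, swap_apply_left, hxy]
          · by_cases huy : e u = y
            · rw [huy, swap_apply_right, hxy]
            · rw [swap_apply_of_ne_of_ne hux huy]
      rw [mul_assoc]
      omega
    · have h₂ := numOrbits_swap_mul_lt (e * g) x y h
      rw [mul_assoc]
      omega

end Equiv.Perm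

/-! ### Resolutions as permutations of the darts. -/

/-- The next half-edge clockwise at the same crossing. -/
def Dart.cw {n : ℕ} (d : Dart n) : Dart n := (d.1, d.2 - 1)

theorem Dart.cw_ccw {n : ℕ} (d : Dart n) : d.ccw.cw = d := Prod.ext rfl (add_sub_cancel_right _ _)

theorem Dart.ccw_cw {n : ℕ} (d : Dart n) : d.cw.ccw = d := Prod.ext rfl (sub_add_cancel _ _)

theorem Dart.ccw_ccw_ccw_ccw {n : ℕ} (d : Dart n) : d.ccw.ccw.ccw.ccw = d := by
  refine Prod.ext rfl ?_
  change d.2 + 1 + 1 + 1 + 1 = d.2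
  generalize d.2 = i
  revert i
  decide

theorem Dart.eq_or_eq_ccw {n : ℕ} {d e : Dart n} (h : d.1 = e.1) :
    d = e ∨ d = e.ccw ∨ d = e.ccw.ccw ∨ d = e.ccw.ccw.ccw := by
  obtain ⟨c, i⟩ := d
  obtain ⟨c', j⟩ := e
  obtain rfl : c = c' := h
  simp only [Dart.ccw, Prod.mk.injEq, true_and]
  revert i j
  decide

namespace LinkDiagram

open Classical in
/-- The next half-edge at the same vertex, in the map obtained by resolving the crossings
as `s` prescribes: kept crossings are 4-valent vertices, the arcs of smoothed ones 2-valent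
vertices. -/
noncomputable def turn {n : ℕ} (D : LinkDiagram n) (s : Fin n → Resolution) (d : Dart n) : Dart n :=
  match s d.1 with
  | Resolution.keep => d.ccw
  | Resolution.smoothA => if D.IsOver d then d.cw else d.ccw
  | Resolution.smoothB => if D.IsOver d then d.ccw else d.cw

open Classical in
/-- Resolve the kept crossings of `s` as `t`. -/
noncomputable def resolveKept {n : ℕ} (s : Fin n → Resolution) (t : Resolution) (c : Fin n) :
    Resolution :=
  if s c = Resolution.keep then t else s c

variable {n : ℕ} (D : LinkDiagram n) (s : Fin n → Resolution)

theorem isOver_ccw (d : Dart n) : D.IsOver d.ccw ↔ ¬ D.IsOver d := by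
  obtain ⟨c, i⟩ := d
  have : ((i + 1 = 0 ∨ i + 1 = 2) ↔ ¬ (i = 0 ∨ i = 2)) := by
    revert i
    decide
  simp only [IsOver, Dart.ccw, this]
  tauto

theorem isOver_cw (d : Dart n) : D.IsOver d.cw ↔ ¬ D.IsOver d := by
  have := D.isOver_ccw d.cw
  rw [Dart.ccw_cw] at this
  tauto

theorem turn_fst (d : Dart n) : (D.turn s d).1 = d.1 := by
  unfold turn
  split
  · rfl
  · split_ifs <;> rfl
  · split_ifs <;> rfl

/-- When `edge` also exchanges over and under, each face consists of over-darts only or of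
under-darts only: a checkerboard colouring. -/
theorem isOver_turn (d : Dart n) : D.IsOver (D.turn s d) ↔ ¬ D.IsOver d := by
  unfold turn
  split
  · exact D.isOver_ccw d
  · split_ifs
    · exact D.isOver_cw d
    · exact D.isOver_ccw d
  · split_ifs
    · exact D.isOver_ccw d
    · exact D.isOver_cw d

theorem turn_injective : Function.Injective (D.turn s) := by
  intro d e h
  have h₁ : d.1 = e.1 := by rw [← D.turn_fst s d, h, D.turn_fst]
  have h₂ : D.IsOver d ↔ D.IsOver e := by
    rw [← not_iff_not, ← D.isOver_turn s, h, D.isOver_turn]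
  have hc : ∀ {d e : Dart n}, d.ccw = e.ccw → d = e := fun {d e} h => by
    rw [← d.cw_ccw, h, e.cw_ccw]
  have hw : ∀ {d e : Dart n}, d.cw = e.cw → d = e := fun {d e} h => by
    rw [← d.ccw_cw, h, e.ccw_cw]
  cases h' : s e.1 <;> by_cases ho : D.IsOver e <;>
    simp only [turn, h₁, h', h₂, ho, if_true, if_false] at h <;>
    first | exact hc h | exact hw h

/-- `turn` as a permutation. -/
noncomputable def turnPerm : Equiv.Perm (Dart n) :=
  Equiv.ofBijective (D.turn s) (Finite.injective_iff_bijective.1 (D.turn_injective s))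

/-- `edge` as a permutation. -/
def edgePerm : Equiv.Perm (Dart n) := ⟨D.edge, D.edge, D.edge_edge, D.edge_edge⟩

theorem numOrbits₂_turnPerm_le :
    Equiv.Perm.numOrbits₂ (D.turnPerm s) D.edgePerm ≤ Nat.card (Quot (D.Joined s)) := by
  refine card_quot_le_of_rel_imp fun d e h => Quot.sound ?_
  change e = D.edge d ∨ e = D.turn s d
  rcases h with h | ⟨h, rfl⟩ | ⟨h, ho, rfl⟩ | ⟨h, ho, rfl⟩
  · exact Or.inl h
  · exact Or.inr (by simp only [turn, h])
  all_goals exact Or.inr (by simp only [turn, h, ho, if_true, if_false])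

/-- There are at least `2 * n` edges, since every edge of an alternating diagram has exactly one
over-end. -/
theorem two_mul_le_numOrbits_edgePerm (hD : D.IsAlternating) :
    2 * n ≤ D.edgePerm.numOrbits := by
  classical
  let u : Fin n → ZMod 4 := fun c => if D.evenOver c then 0 else 1
  have hu : ∀ c (b : Bool), D.IsOver (c, u c + if b then 2 else 0) := by
    intro c b
    unfold IsOver
    cases h : D.evenOver c <;> cases b <;> simp [u, h] <;> decide
  let r : Dart n → Dart n := fun d => if D.IsOver d then d else D.edge d
  have hr : ∀ d e, e = D.edge d → r d = r e := by
    rintro d _ rfl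
    by_cases h : D.IsOver d <;> simp [r, h, hD d, D.edge_edge]
  have hinj : Function.Injective (fun p : Fin n × Bool =>
      Quot.mk (fun d e => e = D.edge d) (p.1, u p.1 + if p.2 then 2 else 0)) := by
    rintro ⟨c, b⟩ ⟨c', b'⟩ h
    have h' := congrArg (Quot.lift r hr) h
    simp only [r, hu, if_true, Prod.mk.injEq] at h'
    obtain ⟨rfl, h'⟩ := h'
    have h' := add_left_cancel h'
    have h02 : (0 : ZMod 4) ≠ 2 := by decide
    cases b <;> cases b' <;> simp_all [eq_comm]
  refine le_of_eq_of_le ?_ (Nat.card_le_card_of_injective _ hinj)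
  simp [mul_comm]

/-- A kept crossing is one vertex, a smoothed one contributes two arcs: (n - k) + 2k = n + k for k =
`T.card`. -/
theorem add_card_le_numOrbits_turnPerm (T : Finset (Fin n))
    (hs : ∀ c, s c = Resolution.keep ↔ c ∉ T) :
    n + T.card ≤ (D.turnPerm s).numOrbits := by
  classical
  -- An invariant of the orbits: at a smoothed crossing, the end of the arc from which it runs
  -- counterclockwise.
  let r : Dart n → Dart n := fun d => match s d.1 with
    | Resolution.keep => (d.1, 0)
    | Resolution.smoothA => if D.IsOver d then d.cw else d
    | Resolution.smoothB => if D.IsOver d then d else d.cw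
  have hr : ∀ d e, e = D.turn s d → r d = r e := by
    rintro d _ rfl
    have ho := D.isOver_turn s d
    simp only [r, ho, D.turn_fst s d]
    cases h : s d.1 <;> by_cases h' : D.IsOver d <;> simp [turn, h, h', Dart.cw_ccw]
  have hfst : ∀ d, (r d).1 = d.1 := by
    intro d
    simp only [r]
    split
    · rfl
    · split_ifs <;> rfl
    · split_ifs <;> rfl
  have hne : ∀ c ∈ T, r (c, 0) ≠ r (c, 2) := by
    intro c hc
    have ho : D.IsOver (c, 2) ↔ D.IsOver (c, 0) := by simp [IsOver]
    simp only [r, ho]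
    have h0 : (0 : ZMod 4) ≠ 2 := by decide
    have h1 : (0 : ZMod 4) - 1 ≠ 2 - 1 := by decide
    cases h : s c
    · exact absurd hc ((hs c).1 h)
    all_goals
      by_cases h' : D.IsOver (c, 0) <;> simp only [h', if_true, if_false, Dart.cw, ne_eq,
        Prod.mk.injEq, true_and, h0, h1, not_false_eq_true]
  let q : Fin n ⊕ T → Dart n := Sum.elim (fun c => (c, 0)) (fun c => (c.1, 2))
  have hinj : Function.Injective (fun p => Quot.mk (fun d e => e = D.turn s d) (q p)) := by
    intro p p' h
    have h' : r (q p) = r (q p') := congrArg (Quot.lift r hr) h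
    have h₁ : (q p).1 = (q p').1 := by rw [← hfst, h', hfst]
    rcases p with c | c <;> rcases p' with c' | c' <;>
      simp only [q, Sum.elim_inl, Sum.elim_inr] at h' h₁
    · rw [h₁]
    · rw [h₁] at h'
      exact absurd h' (hne _ c'.2)
    · rw [h₁] at h'
      exact absurd h'.symm (hne _ (h₁ ▸ c.2))
    · rw [Subtype.ext h₁]
  refine le_of_eq_of_le ?_ (Nat.card_le_card_of_injective _ hinj)
  simp

/-- The faces of a resolution of an alternating diagram are the circles of the two states obtained
by smoothing the remaining crossings all in the same way. -/
theorem card_circles_add_card_circles (hD : D.IsAlternating) :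
    Nat.card (Quot (D.Joined (resolveKept s Resolution.smoothA))) +
      Nat.card (Quot (D.Joined (resolveKept s Resolution.smoothB))) =
    (D.turnPerm s * D.edgePerm).numOrbits := by
  classical
  let R : Dart n → Dart n → Prop := fun d e => e = D.turn s (D.edge d)
  have hR : ∀ d, Quot.mk R d = Quot.mk R (D.turn s (D.edge d)) := fun d => Quot.sound rfl
  have hR' : ∀ d, Quot.mk R (D.edge d) = Quot.mk R (D.turn s d) := fun d => by
    rw [hR, D.edge_edge]
  let rA := D.Joined (resolveKept s Resolution.smoothA)
  let rB := D.Joined (resolveKept s Resolution.smoothB)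
  have hedgeA : ∀ d, Quot.mk rA d = Quot.mk rA (D.edge d) := fun d => Quot.sound (Or.inl rfl)
  have hedgeB : ∀ d, Quot.mk rB d = Quot.mk rB (D.edge d) := fun d => Quot.sound (Or.inl rfl)
  have hA : ∀ d, ¬ D.IsOver d → Quot.mk rA d = Quot.mk rA (D.turn s d) := by
    intro d hd
    cases h : s d.1 <;> simp only [turn, h, hd, if_false]
    · exact Quot.sound (Or.inr (Or.inr (Or.inl ⟨by simp [resolveKept, h], hd, rfl⟩)))
    · exact Quot.sound (Or.inr (Or.inr (Or.inl ⟨by simp [resolveKept, h], hd, rfl⟩)))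
    · refine (Quot.sound (r := rA) (Or.inr (Or.inr (Or.inr
        ⟨?_, (D.isOver_cw d).2 hd, d.ccw_cw.symm⟩)))).symm
      change resolveKept s Resolution.smoothA d.1 = _
      simp [resolveKept, h]
  have hB : ∀ d, D.IsOver d → Quot.mk rB d = Quot.mk rB (D.turn s d) := by
    intro d hd
    cases h : s d.1 <;> simp only [turn, h, hd, if_true]
    · exact Quot.sound (Or.inr (Or.inr (Or.inr ⟨by simp [resolveKept, h], hd, rfl⟩)))
    · refine (Quot.sound (r := rB) (Or.inr (Or.inr (Or.inl
        ⟨?_, fun h => (D.isOver_cw d).1 h hd, d.ccw_cw.symm⟩)))).symm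
      change resolveKept s Resolution.smoothB d.1 = _
      simp [resolveKept, h]
    · exact Quot.sound (Or.inr (Or.inr (Or.inr ⟨by simp [resolveKept, h], hd, rfl⟩)))
  -- Faces of over-darts follow A-circles and faces of under-darts follow B-circles.
  let F : Dart n → Quot rA ⊕ Quot rB := fun d =>
    if D.IsOver d then Sum.inl (Quot.mk rA d) else Sum.inr (Quot.mk rB d)
  have hF : ∀ d e, R d e → F d = F e := by
    rintro d _ rfl
    have ho := (D.isOver_turn s (D.edge d)).trans (not_congr (hD d))
    by_cases h : D.IsOver d
    · simp only [F, ho, h, not_true, not_false_eq_true, if_true]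
      rw [hedgeA, hA _ (by rw [hD]; exact not_not.2 h)]
    · simp only [F, ho, h, not_true, not_false_eq_true, if_false]
      rw [hedgeB, hB _ ((hD d).2 h)]
  -- Inversely, a circle is sent to the face of its over-darts (under-darts for `GB`); a dart of the
  -- wrong kind is replaced by the other end of its edge.
  let GA : Dart n → Quot R := fun d => if D.IsOver d then Quot.mk R d else Quot.mk R (D.edge d)
  let GB : Dart n → Quot R := fun d => if D.IsOver d then Quot.mk R (D.edge d) else Quot.mk R d
  have hGA : ∀ d e, rA d e → GA d = GA e := by
    have hkeep : ∀ d : Dart n, resolveKept s Resolution.smoothA d.1 ≠ Resolution.keep := by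
      intro d
      unfold resolveKept
      split_ifs with h
      · simp
      · exact h
    rintro d e (rfl | ⟨h, rfl⟩ | ⟨h, ho, rfl⟩ | ⟨h, ho, rfl⟩)
    · by_cases h : D.IsOver d <;> simp [GA, h, hD d, D.edge_edge]
    · exact absurd h (hkeep d)
    · simp only [GA, ho, D.isOver_ccw, if_false, not_false_eq_true, if_true, hR']
      have : s d.1 ≠ Resolution.smoothB := by
        intro h'
        simp [resolveKept, h'] at h
      cases h' : s d.1 <;> first | exact absurd h' this | simp [turn, h', ho]
    · simp only [GA, ho, D.isOver_ccw, not_true, if_false, if_true, hR']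
      have : s d.1 = Resolution.smoothB := by
        by_cases h' : s d.1 = Resolution.keep <;> simp [resolveKept, h'] at h
        exact h
      have h₂ : s d.ccw.1 = Resolution.smoothB := this
      simp [turn, h₂, D.isOver_ccw, ho, Dart.cw_ccw]
  have hGB : ∀ d e, rB d e → GB d = GB e := by
    have hkeep : ∀ d : Dart n, resolveKept s Resolution.smoothB d.1 ≠ Resolution.keep := by
      intro d
      unfold resolveKept
      split_ifs with h
      · simp
      · exact h
    rintro d e (rfl | ⟨h, rfl⟩ | ⟨h, ho, rfl⟩ | ⟨h, ho, rfl⟩)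
    · by_cases h : D.IsOver d <;> simp [GB, h, hD d, D.edge_edge]
    · exact absurd h (hkeep d)
    · simp only [GB, ho, D.isOver_ccw, not_false_eq_true, if_false, if_true, hR']
      have : s d.1 = Resolution.smoothA := by
        by_cases h' : s d.1 = Resolution.keep <;> simp [resolveKept, h'] at h
        exact h
      have h₂ : s d.ccw.1 = Resolution.smoothA := this
      simp [turn, h₂, D.isOver_ccw, ho, Dart.cw_ccw]
    · simp only [GB, ho, D.isOver_ccw, if_false, not_true, if_true, hR']
      have : s d.1 ≠ Resolution.smoothA := by
        intro h'
        simp [resolveKept, h'] at h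
      cases h' : s d.1 <;> first | exact absurd h' this | simp [turn, h', ho]
  rw [← Nat.card_sum]
  refine Nat.card_congr ⟨Sum.elim (Quot.lift GA hGA) (Quot.lift GB hGB), Quot.lift F hF, ?_, ?_⟩
  · rintro (q | q) <;> induction q using Quot.inductionOn with | h d => ?_
    · by_cases h : D.IsOver d <;> simp [GA, F, h, hD d, ← hedgeA, rA]
    · by_cases h : D.IsOver d <;> simp [GB, F, h, hD d, ← hedgeB, rB]
  · intro q
    induction q using Quot.inductionOn with | h d => ?_
    by_cases h : D.IsOver d <;> simp only [GA, GB, F, h, if_true, if_false, Sum.elim_inl, Sum.elim_inr] <;> rfl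

/-! ### Changing smoothings and switching crossings. -/

/-- Undoing one smoothing joins at most two components. -/
theorem card_joined_le_update_keep (c : Fin n) :
    Nat.card (Quot (D.Joined s)) ≤
      Nat.card (Quot (D.Joined (Function.update s c Resolution.keep))) + 1 := by
  classical
  -- At a smoothed crossing `e` is chosen so that `e` and `e.ccw` lie on different arcs; identifying
  -- these two merges all four darts.
  obtain ⟨e, hec, he⟩ : ∃ e : Dart n, e.1 = c ∧
      (s c = Resolution.keep ∨ (s c = Resolution.smoothA ∧ D.IsOver e) ∨
        (s c = Resolution.smoothB ∧ ¬ D.IsOver e)) := by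
    cases h : s c
    · exact ⟨(c, 0), rfl, by simp⟩
    · by_cases h0 : D.IsOver (c, 0)
      · exact ⟨(c, 0), rfl, by simp [h0]⟩
      · exact ⟨Dart.ccw (c, 0), rfl, by simp [D.isOver_ccw, h0]⟩
    · by_cases h0 : D.IsOver (c, 0)
      · exact ⟨Dart.ccw (c, 0), rfl, by simp [D.isOver_ccw, h0]⟩
      · exact ⟨(c, 0), rfl, by simp [h0]⟩
  refine card_quot_le_card_quot_add_one e e.ccw fun d d' h => ?_
  by_cases hd : d.1 = c
  swap
  · left
    refine Quot.sound ?_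
    simpa only [Joined, Function.update_of_ne hd] using h
  rcases h with h | h
  · exact Or.inl (Quot.sound (Or.inl h))
  obtain rfl : d' = d.ccw := by tauto
  rcases he with hk | he
  · exact Or.inl (Quot.sound (Or.inr (Or.inl ⟨hd ▸ hk, rfl⟩)))
  have hstep : ∀ x : Dart n, x.1 = c → (D.IsOver x ↔ ¬ D.IsOver e) →
      Quot.mk (D.Joined s) x = Quot.mk (D.Joined s) x.ccw := by
    intro x hx hxo
    refine Quot.sound (Or.inr (Or.inr ?_))
    rw [hx]
    tauto
  have h₁ := hstep e.ccw hec (D.isOver_ccw e)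
  have h₃ := hstep e.ccw.ccw.ccw hec (by simp only [D.isOver_ccw, not_not])
  rw [Dart.ccw_ccw_ccw_ccw] at h₃
  rcases Dart.eq_or_eq_ccw (hd.trans hec.symm) with rfl | rfl | rfl | rfl
  · exact Or.inr (Or.inl ⟨rfl, rfl⟩)
  · exact Or.inl h₁
  · exact Or.inr (Or.inr ⟨h₁.symm, h₃⟩)
  · rw [Dart.ccw_ccw_ccw_ccw]
    exact Or.inl h₃

open Classical in
theorem card_joined_le_keep_add_card (T : Finset (Fin n)) :
    Nat.card (Quot (D.Joined s)) ≤
      Nat.card (Quot (D.Joined fun c => if c ∈ T then Resolution.keep else s c)) + T.card := by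
  induction T using Finset.induction_on with
  | empty => simp
  | insert c T hc ih =>
    have h := D.card_joined_le_update_keep (fun c => if c ∈ T then Resolution.keep else s c) c
    have he : Function.update (fun c => if c ∈ T then Resolution.keep else s c) c Resolution.keep =
        fun c' => if c' ∈ insert c T then Resolution.keep else s c' := by
      funext c'
      by_cases hcc : c' = c
      · subst hcc; simp
      · simp [hcc]
    rw [he] at h
    rw [Finset.card_insert_of_notMem hc]
    omega

/-- Two states that differ only at the crossings in `T` have numbers of components that differ
by at most the size of `T`. -/
theorem card_joined_le_add_card (T : Finset (Fin n)) (s' : Fin n → Resolution)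
    (h : ∀ c ∉ T, s' c = s c) :
    Nat.card (Quot (D.Joined s)) ≤ Nat.card (Quot (D.Joined s')) + T.card := by
  classical
  -- Compare through the diagram with `T` kept, a common coarsening of both states.
  refine (D.card_joined_le_keep_add_card s T).trans (Nat.add_le_add_right ?_ _)
  refine card_quot_le_of_rel_imp fun d d' hd => Quot.sound ?_
  by_cases hT : d.1 ∈ T
  · unfold Joined at hd ⊢
    simp only [hT, if_true]
    tauto
  · simpa only [Joined, hT, if_false, h _ hT] using hd

/-- The smoothing that has the same arcs after the crossing is switched. -/
def _root_.Resolution.swap : Resolution → Resolution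
  | Resolution.keep => Resolution.keep
  | Resolution.smoothA => Resolution.smoothB
  | Resolution.smoothB => Resolution.smoothA

theorem isOver_switch (T : Finset (Fin n)) (d : Dart n) :
    (D.switch T).IsOver d ↔ (D.IsOver d ↔ d.1 ∉ T) := by
  unfold IsOver switch
  by_cases h : d.1 ∈ T
  · simp only [h, if_true, not_true]
    cases D.evenOver d.1 <;> (simp; try tauto)
  · simp only [h, if_false, not_false_eq_true, iff_true]

theorem joined_switch (T : Finset (Fin n)) :
    (D.switch T).Joined (fun c => if c ∈ T then (s c).swap else s c) = D.Joined s := by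
  funext d d'
  by_cases h : d.1 ∈ T
  · cases h' : s d.1 <;> simp [Joined, isOver_switch, h, h', Resolution.swap] <;> rfl
  · cases h' : s d.1 <;> simp [Joined, isOver_switch, h, h'] <;> rfl

/-! ### Euler characteristic bounds for alternating diagrams. -/

/-- If smoothing the crossings in `T` as `s` prescribes gives a connected diagram, then it has
at most as many faces as a connected plane map with `n - #T` crossings. -/
theorem card_circles_add_card_circles_le (hD : D.IsAlternating) (T : Finset (Fin n))
    (hs : ∀ c, s c = Resolution.keep ↔ c ∉ T) (hc : Nat.card (Quot (D.Joined s)) ≤ 1) :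
    Nat.card (Quot (D.Joined (resolveKept s Resolution.smoothA))) +
      Nat.card (Quot (D.Joined (resolveKept s Resolution.smoothB))) + T.card ≤ n + 2 := by
  have h₁ := (D.turnPerm s).numOrbits_add_numOrbits_add_numOrbits_mul_le D.edgePerm
  have h₂ := D.numOrbits₂_turnPerm_le s
  have h₃ := D.two_mul_le_numOrbits_edgePerm hD
  have h₄ := D.add_card_le_numOrbits_turnPerm s T hs
  rw [D.card_circles_add_card_circles s hD]
  have h₅ : Nat.card (Dart n) = n * 4 := by simp
  omega

/-- Euler's formula with at least `2 * n` edges and, as `0 < n`, at least one component. -/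
theorem add_two_le_card_circles_add_card_circles (hD : D.IsAlternating) (hn : 0 < n) :
    n + 2 ≤ Nat.card (Quot (D.Joined fun _ => Resolution.smoothA)) +
      Nat.card (Quot (D.Joined fun _ => Resolution.smoothB)) := by
  have h₁ := D.card_circles_add_card_circles (fun _ => Resolution.keep) hD
  have hk : ∀ t, resolveKept (fun _ : Fin n => Resolution.keep) t = fun _ => t := fun t => by
    funext c
    simp [resolveKept]
  rw [hk, hk] at h₁
  have h₂ := D.spherical
  have h₃ : 2 * n ≤ Nat.card (Quot fun d d' : Dart n => d' = D.edge d) :=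
    D.two_mul_le_numOrbits_edgePerm hD
  have h₄ : (D.turnPerm (fun _ => Resolution.keep) * D.edgePerm).numOrbits =
    Nat.card (Quot fun d d' : Dart n => d' = (D.edge d).ccw) := rfl
  have h₅ : 0 < Nat.card (Quot fun d d' : Dart n => d' = D.edge d ∨ d' = d.ccw) :=
    @Nat.card_pos _ ⟨Quot.mk _ (⟨0, hn⟩, 0)⟩ _
  omega

end LinkDiagram

/-! ### The theorem. -/

open LinkDiagram in
theorem theorem1 {n k : ℕ} (D : LinkDiagram n) (hD : D.IsAlmostAlternating k)
    (T : Finset (Fin n)) (hT : D.IsDealternatorSet k T) (hc : D.IsDealternatorConnected T) :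
    (D.circlesA : ℤ) + (D.circlesB : ℤ) = (n : ℤ) + 2 - 2 * (k : ℤ) := by
  classical
  obtain ⟨rfl, hE⟩ := hT
  let sA : Fin n → Resolution := fun c => if c ∈ T then Resolution.smoothA else Resolution.keep
  let sB : Fin n → Resolution := fun c => if c ∈ T then Resolution.smoothB else Resolution.keep
  have hsA : ∀ c, sA c = Resolution.keep ↔ c ∉ T := fun c => by
    by_cases h : c ∈ T <;> simp [sA, h]
  have hsB : ∀ c, sB c = Resolution.keep ↔ c ∉ T := fun c => by
    by_cases h : c ∈ T <;> simp [sB, h]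
  have hcA : Nat.card (Quot (D.Joined sA)) + D.freeCircles = 1 := hc sA hsA
  have hcB : Nat.card (Quot (D.Joined sB)) + D.freeCircles = 1 := hc sB hsB
  -- Without crossings, connectedness forces exactly one free circle, counted once in each state.
  rcases Nat.eq_zero_or_pos n with rfl | hn
  · have h0 : T.card = 0 := by rw [Finset.card_eq_zero]; exact Finset.eq_empty_of_isEmpty T
    have hz : ∀ r : Dart 0 → Dart 0 → Prop, Nat.card (Quot r) = 0 := fun r =>
      @Nat.card_of_isEmpty _ ⟨fun q => Quot.inductionOn q fun d => d.1.elim0⟩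
    simp only [circlesA, circlesB, numComponents, hz, h0] at hcA ⊢
    omega
  have hpos : 0 < Nat.card (Quot (D.Joined sA)) :=
    @Nat.card_pos _ ⟨Quot.mk _ (⟨0, hn⟩, 0)⟩ _
  have hfree : D.freeCircles = 0 := by omega
  let E := D.switch T
  let mixed : Resolution → Resolution → Fin n → Resolution := fun t u c => if c ∈ T then t else u
  have hjoin : ∀ t u, D.Joined (mixed t u) = E.Joined (mixed t.swap u) := fun t u => by
    rw [← D.joined_switch (mixed t u) T]
    congr 1
    funext c
    by_cases h : c ∈ T <;> simp [mixed, h]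
  have hconst : ∀ t, mixed t t = fun _ => t := fun t => by
    funext c
    simp [mixed]
  have hres : ∀ t u, t ≠ Resolution.keep →
      resolveKept (mixed t Resolution.keep) u = mixed t u := fun t u ht => by
    funext c
    by_cases h : c ∈ T <;> simp [mixed, resolveKept, h, ht]
  have hA : D.circlesA =
      Nat.card (Quot (E.Joined (mixed Resolution.smoothB Resolution.smoothA))) := by
    unfold circlesA numComponents
    rw [hfree, ← hconst, hjoin]
    rfl
  have hB : D.circlesB =
      Nat.card (Quot (E.Joined (mixed Resolution.smoothA Resolution.smoothB))) := by
    unfold circlesB numComponents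
    rw [hfree, ← hconst, hjoin]
    rfl
  -- B-smoothing `T` in `E` is A-smoothing `T` in `D`.
  have hjA : Nat.card (Quot (E.Joined sB)) ≤ 1 := by
    change Nat.card (Quot (E.Joined (mixed Resolution.smoothA.swap Resolution.keep))) ≤ 1
    rw [← hjoin]
    exact le_of_le_of_eq (Nat.le_add_right _ _) hcA
  have hjB : Nat.card (Quot (E.Joined sA)) ≤ 1 := by
    change Nat.card (Quot (E.Joined (mixed Resolution.smoothB.swap Resolution.keep))) ≤ 1
    rw [← hjoin]
    exact le_of_le_of_eq (Nat.le_add_right _ _) hcB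
  have h₁ := E.card_circles_add_card_circles_le sA hE T hsA hjB
  have h₂ := E.card_circles_add_card_circles_le sB hE T hsB hjA
  change Nat.card (Quot (E.Joined (resolveKept (mixed _ _) _))) +
    Nat.card (Quot (E.Joined (resolveKept (mixed _ _) _))) + _ ≤ _ at h₁ h₂
  rw [hres _ _ (by simp), hres _ _ (by simp)] at h₁ h₂
  rw [hconst] at h₁ h₂
  have h₃ := E.add_two_le_card_circles_add_card_circles hE hn
  have h₄ := E.card_joined_le_add_card (fun _ => Resolution.smoothA) T
    (mixed Resolution.smoothB Resolution.smoothA) fun c h => by simp [mixed, h]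
  have h₅ := E.card_joined_le_add_card (fun _ => Resolution.smoothB) T
    (mixed Resolution.smoothA Resolution.smoothB) fun c h => by simp [mixed, h]
  rw [hA, hB]
  -- Upper bound: `h₁` + `h₂` - `h₃`. Lower bound: `h₃` + `h₄` + `h₅`.
  omega
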